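/- Call a random probability measure $\tilde m$ on a measurable space $(\Omega,\mathcal F)$ a Dirichlet process with parameter $\alpha$, where $\alpha$ is a finite measure on $(\Omega,\mathcal F)$ with $\alpha(\Omega)>0$, if for every finite measurable partition $C_1,\dots,C_{n+1}$ of $\Omega$ the random vector $(\tilde m(C_1),\dots,\tilde m(C_{n+1}))$ has the Dirichlet distribution with parameter $(\alpha(C_1),\dots,\alpha(C_{n+1}))$. Here the Dirichlet distribution with parameter $(b_1,\dots,b_{n+1})$, all $b_i>0$, is the law of a vector $(Y_1,\dots,Y_{n+1})$ with $\sum_i Y_i=1$ such that $(Y_1,\dots,Y_n)$ has density $$\frac{\Gamma(b_1+\dots+b_{n+1})}{\Gamma(b_1)\cdots\Gamma(b_{n+1})}\,u_1^{b_1-1}\cdots u_n^{b_n-1}\,(1-u_1-\dots-u_n)^{b_{n+1}-1}$$ on $\{u\in\mathbb R^n: u_i>0 \text{ for all } i,\ u_1+\dots+u_n<1\}$; if some (but not all) $b_i$ are $0$, the corresponding coordinates are almost surely $0$ and the remaining coordinates have the Dirichlet distribution with the remaining parameters. **Theorem 9.** Let $\alpha$ be a finite measure on a measurable space $(\Omega,\mathcal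 F)$ with $\alpha(\Omega)>0$, let $\tilde m$ be a Dirichlet process on $(\Omega,\mathcal F)$ with parameter $\alpha$, and let $f:\Omega\to\mathbb R$ be a measurable function such that $\int_\Omega\log(1+|f|)\,d\alpha<+\infty$. Let $\tilde\varphi$ be a Dirichlet process on $(\mathbb R,\mathcal B(\mathbb R))$ with parameter $\alpha\circ f^{-1}$ (possibly defined on another probability space). Then $\int_\Omega|f|\,d\tilde m<+\infty$ and $\int_{\mathbb R}|x|\,\tilde\varphi(dx)<+\infty$ almost surely, and the random variables $\tilde m(f)=\int_\Omega f\,d\tilde m$ and $\tilde\varphi(I)=\int_{\mathbb R}x\,\tilde\varphi(dx)$ have the same probability distribution. -/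

import Mathlib

open MeasureTheory ProbabilityTheory
open scoped ENNReal

/-- The density, with respect to Lebesgue measure on `ℝⁿ`, of the Dirichlet distribution with
strictly positive parameter `(b₁, …, bₙ, bₙ₊₁)`:
`Γ(∑ bᵢ) / ∏ Γ(bᵢ) * u₁ ^ (b₁ - 1) ⋯ uₙ ^ (bₙ - 1) * (1 - ∑ uᵢ) ^ (bₙ₊₁ - 1)` on the open simplex
`{u : uᵢ > 0 for all i, ∑ uᵢ < 1}`, and `0` elsewhere. -/
noncomputable def dirichletPDFReal {n : ℕ} (b : Fin (n + 1) → ℝ) (u : Fin n → ℝ) : ℝ :=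
  open Classical in
  if (∀ i, 0 < u i) ∧ ∑ i, u i < 1 then
    Real.Gamma (∑ i, b i) / (∏ i, Real.Gamma (b i)) *
      (∏ i : Fin n, u i ^ (b i.castSucc - 1)) * (1 - ∑ i, u i) ^ (b (Fin.last n) - 1)
  else 0

/-- The Dirichlet distribution on `ℝⁿ` with strictly positive parameter `(b₁, …, bₙ, bₙ₊₁)`. -/
noncomputable def dirichletMeasure {n : ℕ} (b : Fin (n + 1) → ℝ) : Measure (Fin n → ℝ) :=
  volume.withDensity fun u => ENNReal.ofReal (dirichletPDFReal b u)

/-- The random vector `Y = (Y₁, …, Yₙ₊₁)` has the Dirichlet distribution with parameter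
`b = (b₁, …, bₙ₊₁)`, where all `bᵢ ≥ 0` and some `bᵢ > 0`. Its coordinates sum to `1`, so it is
determined by all of them but one. Coordinates with parameter `0` vanish almost surely, and the
remaining ones, taken in increasing order of the index (`e` enumerates them) and without the last,
have the Dirichlet density. If all `bᵢ` are positive then `e` is the identity and
this says that `(Y₁, …, Yₙ)` has law `dirichletMeasure b`. -/
structure HasDirichletLaw {S : Type*} [MeasurableSpace S] (P : Measure S) {n : ℕ}
    (Y : S → Fin (n + 1) → ℝ) (b : Fin (n + 1) → ℝ) : Prop where
  aemeasurable : AEMeasurable Y P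
  nonneg : ∀ i, 0 ≤ b i
  sum_eq_one : ∀ᵐ s ∂P, ∑ i, Y s i = 1
  eq_zero : ∀ i, b i = 0 → ∀ᵐ s ∂P, Y s i = 0
  map_eq : ∀ (k : ℕ) (e : Fin (k + 1) ↪o Fin (n + 1)), Set.range e = {i | 0 < b i} →
    P.map (fun s (j : Fin k) => Y s (e j.castSucc)) = dirichletMeasure fun j => b (e j)

/-- The random probability measure `m` on `Ω` (a Markov kernel from the sample space `S`, which
carries the probability `P`, to `Ω`) is a Dirichlet process with parameter `α`: for every finite
measurable partition `C₁, …, Cₙ₊₁` of `Ω`, the vector `(m(C₁), …, m(Cₙ₊₁))` has the Dirichlet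
distribution with parameter `(α(C₁), …, α(Cₙ₊₁))`. -/
def IsDirichletProcess {S Ω : Type*} [MeasurableSpace S] [MeasurableSpace Ω]
    (P : Measure S) (m : Kernel S Ω) (α : Measure Ω) : Prop :=
  ∀ (n : ℕ) (C : Fin (n + 1) → Set Ω), (∀ i, MeasurableSet (C i)) →
    Pairwise (fun i j => Disjoint (C i) (C j)) → (⋃ i, C i) = Set.univ →
    HasDirichletLaw P (fun s i => (m s).real (C i)) (fun i => α.real (C i))

/-! The image of `m` under `f` is a Dirichlet process on the line with parameter `α.map f`, because
the preimage of a partition is a partition. It remains to see that two Dirichlet processes with a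
common parameter give integrals with a common law, and that these integrals exist.

For a simple function the integral is a fixed linear form in the masses of a finite partition, whose
joint law the parameter determines. An almost surely integrable function follows by approximation:
almost sure convergence gives convergence in distribution, and limits in distribution are unique.

Existence rests on Beta marginals. The Beta density has normalizing constant O(α(A)), so the mass of
A exceeds δ with probability O(α(A)(1 + log(1/δ))). On the layer n ≤ log(1 + |f|) < n + 1 take δ =
exp(-2(n + 1)). The probabilities are summable because log(1 + |f|) is integrable, and
Borel–Cantelli bounds the masses of all but finitely many layers, enough to beat |f| ≤ exp(n + 1).
-/

open Filter Topology

/-! ### Equality of laws for a common parameter -/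

/-- The Dirichlet law of a random vector is determined by its parameter. -/
theorem HasDirichletLaw.identDistrib {S S' : Type*} [MeasurableSpace S] [MeasurableSpace S']
    {P : Measure S} {Q : Measure S'} [IsProbabilityMeasure P] {n : ℕ}
    {Y : S → Fin (n + 1) → ℝ} {Z : S' → Fin (n + 1) → ℝ} {b : Fin (n + 1) → ℝ}
    (hY : HasDirichletLaw P Y b) (hZ : HasDirichletLaw Q Z b) : IdentDistrib Y Z P Q := by
  classical
  obtain ⟨i₀, hi₀⟩ : ∃ i, 0 < b i := by
    by_contra! h
    have h0 : ∀ᵐ s ∂P, ∀ i, Y s i = 0 :=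
      ae_all_iff.2 fun i => hY.eq_zero i (le_antisymm (h i) (hY.nonneg i))
    have : ∀ᵐ s ∂P, False := by
      filter_upwards [h0, hY.sum_eq_one] with s h₁ h₂
      simp [h₁] at h₂
    exact (this.exists).elim fun _ h => h
  set T : Finset (Fin (n + 1)) := Finset.univ.filter fun i => 0 < b i with hT
  obtain ⟨k, hk⟩ : ∃ k, T.card = k + 1 :=
    Nat.exists_eq_succ_of_ne_zero (Finset.card_pos.2 ⟨i₀, by simp [hT, hi₀]⟩).ne'
  set e := T.orderEmbOfFin hk
  have he : Set.range e = {i | 0 < b i} := by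
    rw [Finset.range_orderEmbOfFin]; ext; simp [hT]
  -- Rebuilds the whole vector from its positive-parameter coordinates except the last: that one is
  -- one minus the sum of the others, and coordinates off the range of `e` are zero.
  let g : (Fin k → ℝ) → Fin (n + 1) → ℝ := fun v i =>
    (∑ j : Fin k, if e j.castSucc = i then v j else 0) +
      if e (Fin.last k) = i then 1 - ∑ j, v j else 0
  have hg : Measurable g := by
    refine measurable_pi_lambda _ fun i => ?_
    refine Measurable.add (Finset.measurable_sum _ fun j _ => ?_) ?_ <;> split_ifs <;> fun_prop
  have key : ∀ y : Fin (n + 1) → ℝ, ∑ i, y i = 1 → (∀ i, b i = 0 → y i = 0) →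
      g (fun j => y (e j.castSucc)) = y := by
    intro y hy hy0
    have hsum : ∑ j : Fin (k + 1), y (e j) = 1 := by
      rw [← hy, ← Finset.sum_image (f := y) (s := Finset.univ) (g := e)
        (fun _ _ _ _ h => e.injective h)]
      refine Finset.sum_subset (Finset.subset_univ _) fun i _ hi => hy0 i ?_
      by_contra hb
      have : i ∈ Set.range e := by
        rw [he]; exact lt_of_le_of_ne (hY.nonneg i) (Ne.symm hb)
      exact hi (by simpa using this)
    rw [Fin.sum_univ_castSucc] at hsum
    have hlast : 1 - ∑ j : Fin k, y (e j.castSucc) = y (e (Fin.last k)) := by linarith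
    funext i
    simp only [g, hlast]
    rw [← Fin.sum_univ_castSucc (fun j => if e j = i then y (e j) else 0)]
    by_cases hi : i ∈ Set.range e
    · obtain ⟨j, rfl⟩ := hi
      simp
    · rw [Finset.sum_eq_zero fun j _ => if_neg fun h => hi ⟨j, h⟩]
      rw [he] at hi
      exact (hy0 i (le_antisymm (not_lt.1 hi) (hY.nonneg i))).symm
  have measP : AEMeasurable (fun s (j : Fin k) => Y s (e j.castSucc)) P :=
    (measurable_pi_lambda (fun (y : Fin (n + 1) → ℝ) (j : Fin k) => y (e j.castSucc))
      fun j => measurable_pi_apply _).comp_aemeasurable hY.aemeasurable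
  have measQ : AEMeasurable (fun s (j : Fin k) => Z s (e j.castSucc)) Q :=
    (measurable_pi_lambda (fun (y : Fin (n + 1) → ℝ) (j : Fin k) => y (e j.castSucc))
      fun j => measurable_pi_apply _).comp_aemeasurable hZ.aemeasurable
  have base : IdentDistrib (fun s (j : Fin k) => Y s (e j.castSucc))
      (fun s (j : Fin k) => Z s (e j.castSucc)) P Q :=
    ⟨measP, measQ, by rw [hY.map_eq k e he, hZ.map_eq k e he]⟩
  have h1 : Y =ᵐ[P] g ∘ fun s (j : Fin k) => Y s (e j.castSucc) := by
    filter_upwards [hY.sum_eq_one, ae_all_iff.2 fun i => ae_all_iff.2 (hY.eq_zero i)] with s h₁ h₂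
    exact (key _ h₁ h₂).symm
  have h2 : g ∘ (fun s (j : Fin k) => Z s (e j.castSucc)) =ᵐ[Q] Z := by
    filter_upwards [hZ.sum_eq_one, ae_all_iff.2 fun i => ae_all_iff.2 (hZ.eq_zero i)] with s h₁ h₂
    exact key _ h₁ h₂
  exact ((IdentDistrib.of_ae_eq hY.aemeasurable h1).trans (base.comp hg)).trans
    (IdentDistrib.of_ae_eq (hg.comp_aemeasurable measQ) h2)

/-- Integrals of a simple function against two Dirichlet processes with the same parameter have
the same law. -/
theorem IsDirichletProcess.identDistrib_simpleFunc {Ω S S' : Type*} [MeasurableSpace Ω]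
    [MeasurableSpace S] [MeasurableSpace S'] {α : Measure Ω}
    {P : Measure S} {Q : Measure S'} [IsProbabilityMeasure P] [IsProbabilityMeasure Q]
    {m : Kernel S Ω} {φ : Kernel S' Ω} [IsMarkovKernel m] [IsMarkovKernel φ]
    (hm : IsDirichletProcess P m α) (hφ : IsDirichletProcess Q φ α) (g : SimpleFunc Ω ℝ) :
    IdentDistrib (fun s => g.integral (m s)) (fun s => g.integral (φ s)) P Q := by
  obtain ⟨s₀⟩ : Nonempty S := nonempty_of_isProbabilityMeasure P
  obtain ⟨x₀⟩ : Nonempty Ω := nonempty_of_isProbabilityMeasure (m s₀)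
  obtain ⟨n, hn⟩ : ∃ n, g.range.card = n + 1 :=
    Nat.exists_eq_succ_of_ne_zero (Finset.card_pos.2 ⟨g x₀, g.mem_range_self x₀⟩).ne'
  let e := Finset.equivFinOfCardEq hn
  let C : Fin (n + 1) → Set Ω := fun i => g ⁻¹' {(e.symm i : ℝ)}
  have hC : ∀ (μ : Measure Ω) [IsProbabilityMeasure μ],
      g.integral μ = ∑ i, μ.real (C i) * (e.symm i : ℝ) := by
    intro μ _
    rw [SimpleFunc.integral_eq_integral _ (SimpleFunc.integrable_of_isFiniteMeasure g),
      SimpleFunc.integral_eq_sum _ (SimpleFunc.integrable_of_isFiniteMeasure g),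
      ← Finset.sum_coe_sort, ← e.symm.sum_comp]
    rfl
  have hmeas : ∀ i, MeasurableSet (C i) := fun i => g.measurableSet_preimage _
  have hdisj : Pairwise fun i j => Disjoint (C i) (C j) := by
    intro i j hij
    refine Set.disjoint_left.2 fun x hx hx' => hij ?_
    exact e.symm.injective (Subtype.ext ((Set.mem_singleton_iff.1 hx).symm.trans hx'))
  have huniv : ⋃ i, C i = Set.univ := by
    refine Set.eq_univ_of_forall fun x => Set.mem_iUnion.2 ⟨e ⟨g x, g.mem_range_self x⟩, ?_⟩
    simp [C]
  have h := (hm n C hmeas hdisj huniv).identDistrib (hφ n C hmeas hdisj huniv)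
  simp only [hC]
  exact h.comp (u := fun y : Fin (n + 1) → ℝ => ∑ i, y i * (e.symm i : ℝ)) (by fun_prop)

/-- Integrals of an almost surely integrable function against two Dirichlet processes with the
same parameter have the same law. -/
theorem IsDirichletProcess.identDistrib_integral {Ω S S' : Type*} [MeasurableSpace Ω]
    [MeasurableSpace S] [MeasurableSpace S'] {α : Measure Ω}
    {P : Measure S} {Q : Measure S'} [IsProbabilityMeasure P] [IsProbabilityMeasure Q]
    {m : Kernel S Ω} {φ : Kernel S' Ω} [IsMarkovKernel m] [IsMarkovKernel φ]
    (hm : IsDirichletProcess P m α) (hφ : IsDirichletProcess Q φ α) {f : Ω → ℝ}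
    (hf : Measurable f) (hmf : ∀ᵐ s ∂P, Integrable f (m s))
    (hφf : ∀ᵐ s ∂Q, Integrable f (φ s)) :
    IdentDistrib (fun s => ∫ x, f x ∂(m s)) (fun s => ∫ x, f x ∂(φ s)) P Q := by
  -- One sequence, independent of the measure, whose integrals converge for every measure that
  -- integrates `f`.
  let g : ℕ → SimpleFunc Ω ℝ := SimpleFunc.approxOn f hf Set.univ 0 (Set.mem_univ _)
  have hlim : ∀ μ : Measure Ω, Integrable f μ →
      Tendsto (fun n => (g n).integral μ) atTop (𝓝 (∫ x, f x ∂μ)) := fun μ hμ =>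
    tendsto_integral_approxOn_of_measurable hμ hf (by simp) _ (integrable_zero _ _ _)
  have hid := fun n => hm.identDistrib_simpleFunc hφ (g n)
  have h1 : TendstoInDistribution (fun n s => (g n).integral (m s)) atTop
      (fun s => ∫ x, f x ∂(m s)) (fun _ => P) P :=
    tendstoInDistribution_of_ae_tendsto (fun n => (hid n).aemeasurable_fst)
      (hf.stronglyMeasurable.integral_kernel (κ := m)).measurable.aemeasurable
      (hmf.mono fun s hs => hlim _ hs)
  have h2 : TendstoInDistribution (fun n s => (g n).integral (φ s)) atTop
      (fun s => ∫ x, f x ∂(φ s)) (fun _ => Q) Q :=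
    tendstoInDistribution_of_ae_tendsto (fun n => (hid n).aemeasurable_snd)
      (hf.stronglyMeasurable.integral_kernel (κ := φ)).measurable.aemeasurable
      (hφf.mono fun s hs => hlim _ hs)
  refine ⟨h1.aemeasurable_limit, h2.aemeasurable_limit, ?_⟩
  -- The approximants have equal laws under both processes, so those of `φ` also converge in
  -- distribution to the integral against `m`.
  have h3 : TendstoInDistribution (fun n s => (g n).integral (φ s)) atTop
      (fun s => ∫ x, f x ∂(m s)) (fun _ => Q) P :=
    { forall_aemeasurable := h2.forall_aemeasurable
      aemeasurable_limit := h1.aemeasurable_limit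
      tendsto := by
        refine h1.tendsto.congr fun n => Subtype.ext ?_
        exact (hid n).map_eq }
  exact tendstoInDistribution_unique _ h3 h2

/-- The image of a Dirichlet process is a Dirichlet process. -/
theorem IsDirichletProcess.map {Ω Ω' S : Type*} [MeasurableSpace Ω] [MeasurableSpace Ω']
    [MeasurableSpace S] {α : Measure Ω} {P : Measure S} {m : Kernel S Ω}
    (hm : IsDirichletProcess P m α) {f : Ω → Ω'} (hf : Measurable f) :
    IsDirichletProcess P (m.map f) (α.map f) := by
  intro n C hC hdisj huniv
  have h := hm n (fun i => f ⁻¹' C i) (fun i => hf (hC i)) (fun i j hij => (hdisj hij).preimage f)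
    (by rw [← Set.preimage_iUnion, huniv, Set.preimage_univ])
  simpa only [Kernel.map_apply _ hf, map_measureReal_apply hf (hC _)] using h

/-! ### Tail estimates for the Beta distribution -/

/-- Probabilities of the Dirichlet distribution with two parameters as integrals of the Beta
density. -/
theorem dirichletMeasure_two_apply (b : Fin 2 → ℝ) {B : Set ℝ} (hB : MeasurableSet B)
    (hB' : B ⊆ Set.Ioo 0 1) :
    dirichletMeasure b ((fun v : Fin 1 → ℝ => v 0) ⁻¹' B) =
      ∫⁻ u in B, ENNReal.ofReal (Real.Gamma (b 0 + b 1) / (Real.Gamma (b 0) * Real.Gamma (b 1)) *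
        (u ^ (b 0 - 1) * (1 - u) ^ (b 1 - 1))) := by
  have hpre : MeasurableSet ((fun v : Fin 1 → ℝ => v 0) ⁻¹' B) := measurable_pi_apply 0 hB
  rw [dirichletMeasure, withDensity_apply _ hpre,
    ← (volume_preserving_funUnique (Fin 1) ℝ).setLIntegral_comp_preimage_emb
      (MeasurableEquiv.measurableEmbedding _)]
  refine setLIntegral_congr_fun hpre fun v hv => ?_
  have hv' : 0 < v 0 ∧ v 0 < 1 := hB' hv
  have hadd : ∑ i : Fin (1 + 1), b i = b 0 + b 1 := Fin.sum_univ_two b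
  have hprod : ∏ i : Fin (1 + 1), Real.Gamma (b i) = Real.Gamma (b 0) * Real.Gamma (b 1) :=
    Fin.prod_univ_two _
  simp only [dirichletPDFReal, Fin.forall_fin_one, Fin.sum_univ_one, hv', and_self, if_true,
    hadd, hprod, Fin.prod_univ_one, mul_assoc]
  rfl

/-- The normalizing constant of the Beta density is linear in a small first parameter. -/
theorem betaConst_le {b : Fin 2 → ℝ} (h0 : 0 < b 0) {a : ℝ}
    (ha0 : b 0 ≤ a) (ha1 : b 1 ≤ a)
    (hK : 0 ≤ Real.Gamma (b 0 + b 1) / (Real.Gamma (b 0) * Real.Gamma (b 1)))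
    [IsProbabilityMeasure (dirichletMeasure b)] :
    Real.Gamma (b 0 + b 1) / (Real.Gamma (b 0) * Real.Gamma (b 1)) ≤ 4 ^ a * b 0 := by
  set K := Real.Gamma (b 0 + b 1) / (Real.Gamma (b 0) * Real.Gamma (b 1))
  have hint : IntegrableOn (fun u : ℝ => u ^ (b 0 - 1)) (Set.Ioo 0 (1 / 2)) :=
    (intervalIntegral.integrableOn_Ioo_rpow_iff (by norm_num)).2 (by linarith)
  have hval : ∫ u in Set.Ioo (0 : ℝ) (1 / 2), u ^ (b 0 - 1) = (1 / 2) ^ b 0 / b 0 := by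
    rw [← integral_Ioc_eq_integral_Ioo, ← intervalIntegral.integral_of_le (by norm_num),
      integral_rpow (Or.inl (by linarith))]
    simp [Real.zero_rpow h0.ne']
  -- The interval (0, 1/2) has probability at most one. There the factor in 1 - u is at least
  -- (1/2)^a, and the remaining power of u integrates to a multiple of 1 / `b 0`; this forces `K` to
  -- be O(`b 0`).
  have h1 : ENNReal.ofReal (K * (1 / 2) ^ a * ((1 / 2) ^ b 0 / b 0)) ≤ 1 := by
    refine le_trans ?_ (prob_le_one (μ := dirichletMeasure b)
      (s := (fun v : Fin 1 → ℝ => v 0) ⁻¹' Set.Ioo 0 (1 / 2)))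
    rw [dirichletMeasure_two_apply b measurableSet_Ioo
      (Set.Ioo_subset_Ioo le_rfl (by norm_num)), ← hval, ← integral_const_mul,
      ofReal_integral_eq_lintegral_ofReal (hint.const_mul _)]
    · refine setLIntegral_mono' measurableSet_Ioo fun u hu => ENNReal.ofReal_le_ofReal ?_
      have hu1 : u < 1 / 2 := hu.2
      have : (1 / 2 : ℝ) ^ a ≤ (1 - u) ^ (b 1 - 1) :=
        (Real.rpow_le_rpow (by norm_num) (by linarith) (h0.le.trans ha0)).trans
          (Real.rpow_le_rpow_of_exponent_ge (by linarith) (by linarith [hu.1]) (by linarith))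
      rw [mul_assoc, mul_comm (u ^ _)]
      exact mul_le_mul_of_nonneg_left
        (mul_le_mul_of_nonneg_right this (Real.rpow_nonneg hu.1.le _)) hK
    · refine (ae_restrict_iff' measurableSet_Ioo).2 (.of_forall fun u hu => ?_)
      have := Real.rpow_nonneg hu.1.le (b 0 - 1)
      simp only [Pi.zero_apply]
      positivity
  rw [ENNReal.ofReal_le_one, ← mul_div_assoc, div_le_one h0] at h1
  have h2 : (1 / 2 : ℝ) ^ a ≤ (1 / 2) ^ b 0 :=
    Real.rpow_le_rpow_of_exponent_ge (by norm_num) (by norm_num) ha0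
  have h3 : (4 : ℝ) ^ a * ((1 / 2) ^ a * (1 / 2) ^ a) = 1 := by
    rw [← Real.mul_rpow (by norm_num) (by norm_num), ← Real.mul_rpow (by norm_num) (by norm_num)]
    norm_num
  have h4 : K * (1 / 2) ^ a * (1 / 2) ^ a ≤ b 0 :=
    (mul_le_mul_of_nonneg_left h2 (by positivity)).trans h1
  calc K = 4 ^ a * (K * (1 / 2) ^ a * (1 / 2) ^ a) := by linear_combination (-K) * h3
    _ ≤ 4 ^ a * b 0 := by gcongr

/-- A tail bound for the Beta distribution that is linear in a small first parameter. -/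
theorem dirichletMeasure_tail_le {b : Fin 2 → ℝ} (h0 : 0 < b 0) (h1 : 0 < b 1) {a : ℝ}
    (ha0 : b 0 ≤ a) (ha1 : b 1 ≤ a) [IsProbabilityMeasure (dirichletMeasure b)] {δ : ℝ}
    (hδ : 0 < δ) (hδ1 : δ < 1) :
    dirichletMeasure b ((fun v : Fin 1 → ℝ => v 0) ⁻¹' Set.Ioo δ 1) ≤
      ENNReal.ofReal (4 ^ a * b 0 * (2 * Real.log (1 / δ) + 2 / b 1)) := by
  have hK0 : 0 ≤ Real.Gamma (b 0 + b 1) / (Real.Gamma (b 0) * Real.Gamma (b 1)) := by positivity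
  have hK := betaConst_le h0 ha0 ha1 hK0
  rw [dirichletMeasure_two_apply b measurableSet_Ioo (Set.Ioo_subset_Ioo hδ.le le_rfl)]
  set K := Real.Gamma (b 0 + b 1) / (Real.Gamma (b 0) * Real.Gamma (b 1))
  have hi1 : IntervalIntegrable (fun u : ℝ => 2 * (1 / u)) volume δ 1 := by
    refine (intervalIntegral.intervalIntegrable_one_div (fun x hx => ?_) continuousOn_id).const_mul 2
    rw [Set.uIcc_of_le hδ1.le] at hx
    exact (hδ.trans_le hx.1).ne'
  have hi2 : IntervalIntegrable (fun u : ℝ => 2 * (1 - u) ^ (b 1 - 1)) volume δ 1 := by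
    have := (intervalIntegral.intervalIntegrable_rpow' (a := 1 - δ) (b := 0) (r := b 1 - 1)
      (by linarith)).comp_sub_left 1
    simp only [sub_sub_cancel, sub_zero] at this
    exact this.const_mul 2
  have hval : ∫ u in Set.Ioo δ 1, (2 * (1 / u) + 2 * (1 - u) ^ (b 1 - 1)) =
      2 * Real.log (1 / δ) + 2 * ((1 - δ) ^ b 1 / b 1) := by
    rw [← integral_Ioc_eq_integral_Ioo, ← intervalIntegral.integral_of_le hδ1.le,
      intervalIntegral.integral_add hi1 hi2, intervalIntegral.integral_const_mul,
      intervalIntegral.integral_const_mul, integral_one_div_of_pos hδ one_pos,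
      intervalIntegral.integral_comp_sub_left (fun u : ℝ => u ^ (b 1 - 1)) 1,
      integral_rpow (Or.inl (by linarith))]
    simp [Real.zero_rpow h1.ne']
  have hint : IntegrableOn (fun u : ℝ => 2 * (1 / u) + 2 * (1 - u) ^ (b 1 - 1)) (Set.Ioo δ 1) :=
    ((intervalIntegrable_iff_integrableOn_Ioo_of_le hδ1.le).1 (hi1.add hi2))
  -- Only one endpoint matters at a time: for u ≤ 1/2 the factor in 1 - u is at most 2, and for u ≥
  -- 1/2 the factor in u is at most 2.
  have hpt : ∀ u ∈ Set.Ioo δ 1, 0 ≤ u ^ (b 0 - 1) * (1 - u) ^ (b 1 - 1) ∧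
      u ^ (b 0 - 1) * (1 - u) ^ (b 1 - 1) ≤ 2 * (1 / u) + 2 * (1 - u) ^ (b 1 - 1) := by
    intro u hu
    have hu0 : 0 < u := hδ.trans hu.1
    have hv0 : 0 < 1 - u := by linarith [hu.2]
    have e1 : u ^ (b 0 - 1) ≤ 1 / u := by
      rw [one_div, ← Real.rpow_neg_one]
      exact Real.rpow_le_rpow_of_exponent_ge hu0 hu.2.le (by linarith)
    have e2 : (1 - u) ^ (b 1 - 1) ≤ 1 / (1 - u) := by
      rw [one_div, ← Real.rpow_neg_one]
      exact Real.rpow_le_rpow_of_exponent_ge hv0 (by linarith) (by linarith)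
    have p1 := Real.rpow_nonneg hu0.le (b 0 - 1)
    have p2 := Real.rpow_nonneg hv0.le (b 1 - 1)
    have p3 : 0 < 1 / u := by positivity
    refine ⟨mul_nonneg p1 p2, ?_⟩
    rcases le_total u (1 / 2) with h | h
    · have : 1 / (1 - u) ≤ 2 := by rw [div_le_iff₀ hv0]; linarith
      nlinarith [mul_le_mul e1 (e2.trans this) p2 p3.le]
    · have : 1 / u ≤ 2 := by rw [div_le_iff₀ hu0]; linarith
      nlinarith [mul_le_mul_of_nonneg_right (e1.trans this) p2]
  calc ∫⁻ u in Set.Ioo δ 1, ENNReal.ofReal (K * (u ^ (b 0 - 1) * (1 - u) ^ (b 1 - 1)))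
      ≤ ∫⁻ u in Set.Ioo δ 1,
          ENNReal.ofReal (4 ^ a * b 0 * (2 * (1 / u) + 2 * (1 - u) ^ (b 1 - 1))) := by
        refine setLIntegral_mono' measurableSet_Ioo fun u hu => ENNReal.ofReal_le_ofReal ?_
        exact mul_le_mul hK (hpt u hu).2 (hpt u hu).1 (by positivity)
    _ = ENNReal.ofReal (4 ^ a * b 0 * (2 * Real.log (1 / δ) + 2 * ((1 - δ) ^ b 1 / b 1))) := by
        rw [← hval, ← integral_const_mul, ofReal_integral_eq_lintegral_ofReal (hint.const_mul _)]
        refine (ae_restrict_iff' measurableSet_Ioo).2 (.of_forall fun u hu => ?_)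
        exact mul_nonneg (by positivity) ((hpt u hu).1.trans (hpt u hu).2)
    _ ≤ _ := by
        refine ENNReal.ofReal_le_ofReal ?_
        have : (1 - δ) ^ b 1 ≤ 1 := Real.rpow_le_one (by linarith) (by linarith) h1.le
        have : (1 - δ) ^ b 1 / b 1 ≤ 1 / b 1 := by gcongr
        have : 2 * ((1 - δ) ^ b 1 / b 1) ≤ 2 / b 1 := by
          rw [← mul_one_div 2 (b 1)]; linarith
        gcongr

/-! ### Almost sure integrability -/

/-- The mass that a Dirichlet process gives to a set is unlikely to exceed `δ` when the parameter
measure of that set is small compared to `1 + log (1 / δ)`. -/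
theorem IsDirichletProcess.exists_measure_lt_le {Ω S : Type*} [MeasurableSpace Ω]
    [MeasurableSpace S] {α : Measure Ω} [IsFiniteMeasure α] (hα : 0 < α Set.univ)
    {P : Measure S} [IsProbabilityMeasure P] {m : Kernel S Ω} [IsMarkovKernel m]
    (hm : IsDirichletProcess P m α) :
    ∃ C : ℝ, 0 ≤ C ∧ ∀ A : Set Ω, MeasurableSet A → ∀ δ : ℝ, 0 < δ → δ < 1 →
      P {s | δ < (m s).real A} ≤ ENNReal.ofReal (C * (α.real A * (1 + Real.log (1 / δ)))) := by
  set a := α.real Set.univ with ha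
  have ha0 : 0 < a := ENNReal.toReal_pos hα.ne' (measure_ne_top _ _)
  -- The term 2 / a makes the bound trivial when α(A) ≥ a / 2. Otherwise the complement has
  -- parameter above a / 2, and the Beta tail bound gives the other term.
  refine ⟨2 / a + 4 ^ a * (2 + 4 / a), by positivity, fun A hA δ hδ hδ1 => ?_⟩
  have hlog : 0 ≤ Real.log (1 / δ) := Real.log_nonneg (by rw [le_div_iff₀ hδ]; linarith)
  have hA0 : 0 ≤ α.real A := measureReal_nonneg
  have hcompl : α.real Aᶜ = a - α.real A := measureReal_compl hA
  rcases le_or_gt (a / 2) (α.real A) with hbig | hsmall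
  · refine prob_le_one.trans ?_
    rw [ENNReal.one_le_ofReal]
    have : 1 ≤ 2 / a * α.real A := by rw [div_mul_eq_mul_div, le_div_iff₀ ha0]; linarith
    have : 0 ≤ 4 ^ a * (2 + 4 / a) * (α.real A * (1 + Real.log (1 / δ))) := by positivity
    have : 0 ≤ 2 / a * α.real A * Real.log (1 / δ) := by positivity
    linarith
  have hD : HasDirichletLaw P (fun s i => (m s).real ((![A, Aᶜ] : Fin 2 → Set Ω) i))
      (fun i => α.real ((![A, Aᶜ] : Fin 2 → Set Ω) i)) := by
    refine hm 1 ![A, Aᶜ] ?_ ?_ ?_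
    · simp [Fin.forall_fin_two, hA, hA.compl]
    · intro i j hij
      fin_cases i <;> fin_cases j <;>
        simp_all [disjoint_compl_right, disjoint_compl_left]
    · ext x
      simp [Fin.exists_fin_two, em]
  rcases hA0.eq_or_lt with hzero | hpos
  · have h := hD.eq_zero 0 (by simp [← hzero])
    have : P {s | δ < (m s).real A} = 0 := by
      refine measure_mono_null (fun s (hs : δ < _) => ?_) h
      simpa using (hδ.trans hs).ne'
    simp [this]
  set b : Fin 2 → ℝ := fun i => α.real ((![A, Aᶜ] : Fin 2 → Set Ω) i) with hb
  have hb0 : b 0 = α.real A := by simp [hb]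
  have hb1 : b 1 = a - α.real A := by simp [hb, hcompl]
  have hlaw := hD.map_eq 1 (OrderIso.refl (Fin 2)).toOrderEmbedding (by
    ext i
    have h0 : 0 < b 0 := by linarith
    have h1 : 0 < b 1 := by linarith
    fin_cases i
    · simpa using h0
    · simpa using h1)
  have hmeas : AEMeasurable (fun s (_ : Fin 1) => (m s).real A) P :=
    aemeasurable_pi_lambda _ fun _ => (m.measurable_coe hA).ennreal_toReal.aemeasurable
  have hlaw' : P.map (fun s (_ : Fin 1) => (m s).real A) = dirichletMeasure b := by
    rw [← show (fun j => b ((OrderIso.refl (Fin 2)).toOrderEmbedding j)) = b from rfl, ← hlaw]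
    congr 1
    funext s j
    fin_cases j
    rfl
  have : IsProbabilityMeasure (dirichletMeasure b) := by
    rw [← hlaw']; exact Measure.isProbabilityMeasure_map hmeas
  -- The tail bound covers only (δ, 1); the density vanishes from 1 on.
  have hone : dirichletMeasure b ((fun v : Fin 1 → ℝ => v 0) ⁻¹' Set.Ici 1) = 0 := by
    rw [dirichletMeasure, withDensity_apply _ (measurable_pi_apply 0 measurableSet_Ici)]
    refine (setLIntegral_congr_fun (measurable_pi_apply 0 measurableSet_Ici) (g := fun _ => 0)
      fun v hv => ?_).trans (by simp)
    have hv : 1 ≤ v 0 := hv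
    simp [dirichletPDFReal, hv.not_gt]
  calc P {s | δ < (m s).real A}
      = dirichletMeasure b ((fun v : Fin 1 → ℝ => v 0) ⁻¹' Set.Ioi δ) := by
        rw [← hlaw', Measure.map_apply_of_aemeasurable hmeas
          (measurable_pi_apply 0 measurableSet_Ioi)]
        rfl
    _ ≤ dirichletMeasure b ((fun v : Fin 1 → ℝ => v 0) ⁻¹' Set.Ioo δ 1) := by
        rw [← Set.Ioo_union_Ici_eq_Ioi hδ1, Set.preimage_union]
        exact (measure_union_le _ _).trans (by rw [hone, add_zero])
    _ ≤ ENNReal.ofReal (4 ^ a * b 0 * (2 * Real.log (1 / δ) + 2 / b 1)) :=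
        dirichletMeasure_tail_le (by linarith) (by linarith) (by linarith) (by linarith) hδ hδ1
    _ ≤ _ := by
        refine ENNReal.ofReal_le_ofReal ?_
        rw [hb0, hb1]
        have h1 : 2 / (a - α.real A) ≤ 4 / a := by
          rw [div_le_div_iff₀ (by linarith) ha0]; linarith
        have h2 : 2 * Real.log (1 / δ) + 2 / (a - α.real A) ≤
            (2 + 4 / a) * (1 + Real.log (1 / δ)) := by
          have : 0 ≤ 4 / a * Real.log (1 / δ) := by positivity
          linarith
        calc 4 ^ a * α.real A * (2 * Real.log (1 / δ) + 2 / (a - α.real A))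
            ≤ 4 ^ a * α.real A * ((2 + 4 / a) * (1 + Real.log (1 / δ))) := by gcongr
          _ ≤ _ := by
            have : 0 ≤ 2 / a * (α.real A * (1 + Real.log (1 / δ))) := by positivity
            linarith

/-- A function whose logarithm is integrable with respect to the parameter is almost surely
integrable with respect to the Dirichlet process. -/
theorem IsDirichletProcess.ae_integrable {Ω S : Type*} [MeasurableSpace Ω]
    [MeasurableSpace S] {α : Measure Ω} [IsFiniteMeasure α] (hα : 0 < α Set.univ)
    {P : Measure S} [IsProbabilityMeasure P] {m : Kernel S Ω} [IsMarkovKernel m]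
    (hm : IsDirichletProcess P m α) {f : Ω → ℝ} (hf : Measurable f)
    (hlog : Integrable (fun x => Real.log (1 + |f x|)) α) :
    ∀ᵐ s ∂P, Integrable f (m s) := by
  obtain ⟨C, hC, hbound⟩ := hm.exists_measure_lt_le hα
  let N : Ω → ℕ := fun x => ⌊Real.log (1 + |f x|)⌋₊
  have hN : Measurable N := by fun_prop
  let A : ℕ → Set Ω := fun n => N ⁻¹' {n}
  have hA : ∀ n, MeasurableSet (A n) := fun n => hN (measurableSet_singleton n)
  have hAdisj : Pairwise (Function.onFun Disjoint A) := fun i j hij =>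
    Disjoint.preimage _ (by simpa using hij)
  have hAuniv : ⋃ n, A n = Set.univ :=
    Set.eq_univ_of_forall fun x => Set.mem_iUnion.2 ⟨N x, rfl⟩
  have hle : ∀ x, (N x : ℝ) ≤ Real.log (1 + |f x|) := fun x =>
    Nat.floor_le (Real.log_nonneg (by linarith [abs_nonneg (f x)]))
  have hlt : ∀ x, |f x| ≤ Real.exp (N x + 1) := fun x => by
    have h1 : Real.log (1 + |f x|) < N x + 1 := Nat.lt_floor_add_one _
    have h2 := (Real.log_lt_iff_lt_exp (by positivity)).1 h1
    linarith
  have hpart : ∀ (μ : Measure Ω) (g : ℕ → ℝ≥0∞),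
      ∫⁻ x, g (N x) ∂μ = ∑' n, g n * μ (A n) := by
    intro μ g
    rw [← setLIntegral_univ, ← hAuniv, lintegral_iUnion hA hAdisj]
    refine tsum_congr fun n => ?_
    rw [← setLIntegral_const]
    exact setLIntegral_congr_fun (hA n) fun x hx => by
      rw [show N x = n from hx]
  -- With this threshold log(1/δ) = 2(n + 1) is linear in n, so the sum is dominated by the integral
  -- of an affine function of log(1 + |f|).
  have hsum : ∑' n : ℕ, P {s | Real.exp (-2 * (n + 1)) < (m s).real (A n)} ≠ ∞ := by
    have hfin : ∫⁻ x, ENNReal.ofReal (C * (1 + 2 * (N x + 1))) ∂α ≠ ∞ := by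
      have hi : Integrable (fun x => C * (1 + 2 * (Real.log (1 + |f x|) + 1))) α := by fun_prop
      refine ne_top_of_le_ne_top hi.lintegral_lt_top.ne
        (lintegral_mono fun x => ENNReal.ofReal_le_ofReal ?_)
      have := hle x
      gcongr
    rw [hpart α fun n => ENNReal.ofReal (C * (1 + 2 * (n + 1)))] at hfin
    refine ne_top_of_le_ne_top hfin (ENNReal.tsum_le_tsum fun n => ?_)
    have h := hbound (A n) (hA n) (Real.exp (-2 * (n + 1))) (Real.exp_pos _)
      (Real.exp_lt_one_iff.2 (by linarith [Nat.cast_nonneg (α := ℝ) n]))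
    refine h.trans (le_of_eq ?_)
    rw [one_div, ← Real.exp_neg, Real.log_exp, ← ofReal_measureReal,
      ← ENNReal.ofReal_mul (by positivity)]
    congr 1
    ring
  filter_upwards [ae_eventually_notMem hsum] with s hs
  -- Outside a null set, all but finitely many layers contribute at most exp(n + 1) exp(-2(n + 1)) =
  -- exp(-(n + 1)); the factor 2 in the threshold leaves this geometric decay.
  have hmajor : Integrable (fun x => Real.exp (N x + 1)) (m s) := by
    refine ⟨by fun_prop, ?_⟩
    rw [hasFiniteIntegral_iff_ofReal (.of_forall fun x => (Real.exp_pos _).le),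
      hpart (m s) fun n => ENNReal.ofReal (Real.exp (n + 1))]
    have hS : Summable fun n : ℕ => Real.exp (n + 1) * (m s).real (A n) := by
      refine Summable.of_norm_bounded_eventually_nat (g := fun n : ℕ => Real.exp (-n)) ?_ ?_
      · exact Real.summable_exp_neg_nat
      · filter_upwards [hs] with n hn
        have hn : (m s).real (A n) ≤ Real.exp (-2 * (n + 1)) := not_lt.1 hn
        rw [Real.norm_of_nonneg (by positivity)]
        calc Real.exp (n + 1) * (m s).real (A n)
            ≤ Real.exp (n + 1) * Real.exp (-2 * (n + 1)) := by gcongr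
          _ = Real.exp (-(n + 1)) := by rw [← Real.exp_add]; congr 1; ring
          _ ≤ Real.exp (-n) := Real.exp_le_exp.2 (by linarith)
    have : ∀ n : ℕ, ENNReal.ofReal (Real.exp (n + 1)) * m s (A n) =
        ENNReal.ofReal (Real.exp (n + 1) * (m s).real (A n)) := fun n => by
      rw [ENNReal.ofReal_mul (by positivity), ofReal_measureReal]
    simp only [this]
    exact hS.tsum_ofReal_lt_top
  exact hmajor.mono' hf.aestronglyMeasurable (.of_forall hlt)

/-! ### Transfer to the image process on the line -/

theorem theorem9 {Ω S S' : Type*} [MeasurableSpace Ω] [MeasurableSpace S] [MeasurableSpace S']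
    (α : Measure Ω) [IsFiniteMeasure α] (hα : 0 < α Set.univ)
    (f : Ω → ℝ) (hf : Measurable f)
    (hlog : Integrable (fun x => Real.log (1 + |f x|)) α)
    (P : Measure S) [IsProbabilityMeasure P] (m : Kernel S Ω) [IsMarkovKernel m]
    (hm : IsDirichletProcess P m α)
    (Q : Measure S') [IsProbabilityMeasure Q] (φ : Kernel S' ℝ) [IsMarkovKernel φ]
    (hφ : IsDirichletProcess Q φ (α.map f)) :
    (∀ᵐ s ∂P, Integrable f (m s)) ∧
    (∀ᵐ s ∂Q, Integrable (fun x : ℝ => x) (φ s)) ∧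
    IdentDistrib (fun s => ∫ x, f x ∂(m s)) (fun s => ∫ x, x ∂(φ s)) P Q := by
  have hmf := hm.ae_integrable hα hf hlog
  have hαf : 0 < α.map f Set.univ := by
    rwa [Measure.map_apply hf MeasurableSet.univ, Set.preimage_univ]
  have hφI : ∀ᵐ s ∂Q, Integrable (fun x : ℝ => x) (φ s) :=
    hφ.ae_integrable hαf measurable_id
      ((integrable_map_measure (measurable_const.add measurable_norm).log.aestronglyMeasurable
        hf.aemeasurable).2 hlog)
  refine ⟨hmf, hφI, ?_⟩
  have : IsMarkovKernel (m.map f) := Kernel.IsMarkovKernel.map m hf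
  have h := (hm.map hf).identDistrib_integral hφ measurable_id
    (hmf.mono fun s hs => by
      rw [Kernel.map_apply _ hf]
      exact (integrable_map_measure (by fun_prop) hf.aemeasurable).2 hs) hφI
  have heq : ∀ s, ∫ x, id x ∂(m.map f s) = ∫ x, f x ∂(m s) := fun s => by
    rw [Kernel.map_apply _ hf, integral_map hf.aemeasurable (by fun_prop)]
    rfl
  simp only [heq] at h
  exact h
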